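/- Consider $N$ switches in slotted time $t=0,1,2,\dots$, with queue lengths $L(t)\in\mathbb{N}^{N\times N}$ ($L_{ii}(t)=0$), a nonempty set $\mathcal{S}\subseteq\{0,1\}^{N\times N}$ of feasible schedules, a reconfiguration delay $\Delta_r>0$ (in slots), and arbitrary initial data $L(0)$, $S(-1)\in\mathcal{S}$. In slot $t$ a schedule $S(t)\in\mathcal{S}$ is used, and $L_{ij}(t+1)=L_{ij}(t)-D_{ij}(t)+A_{ij}(t)$. A reconfiguration occurs in slot $s$ if $S(s)\ne S(s-1)$; then $D(s+\tau)=0$ for all integers $0\le\tau\le\Delta_r$. In all other slots $D_{ij}(t)=S_{ij}(t)$ if $L_{ij}(t)>0$, and $D_{ij}(t)=0$ otherwise. The arrivals $A_{ij}(t)$ ($i\neq j$) are $\mathbb{N}$-valued, independent over the queues and i.i.d. over $t$, with rates $\lambda_{ij}=\mathbb{E}A_{ij}(0)$. A scheduling policy chooses $S(t)$, possibly at random, on the basis of $A(0),\dots,A(t)$ and $S(0),\dots,S(t-1)$. It strongly stabilizes the network if $\limsup_{t\to\infty}\frac1t\sum_{\tau<t}\mathbb{E}\sum_{i,j}L_{ij}(\tau)<\infty$.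 Traffic is admissible if some scheduling policy strongly stabilizes the network under it; the capacity region $\Lambda$ is the set of rate matrices of admissible traffic, and the load of $\lambda$ is $\rho(\lambda)=\inf\{r\in(0,1):\lambda\in r\overline{\Lambda}\}$, with $\inf\emptyset=\infty$. A policy is throughput optimal if it strongly stabilizes the network under all admissible traffic with bounded arrivals ($A_{ij}(t)\le A_{\max}<\infty$) and load $\rho(\lambda)<1$. For a schedule $S$ let $W_S(t)=\sum_{i,j}L_{ij}(t)S_{ij}$, and let $W^*(t)=\max_{S\in\mathcal{S}}W_S(t)$. Let $g$ be a nonnegative, continuous and strictly increasing function on $[0,\infty)$ with $g(x)/x\to0$ and $g(x)\to\infty$ as $x\to\infty$. Let $\pi$ be a randomized Markov policy, which generates a random schedule $\Pi(t)\in\mathcal{S}$ with a law that depends only on $(S(t-1),L(t))$; write $W^\pi(t)=W_{\Pi(t)}(t)$. Its $g$-adaptive variant $\pi^g$ uses $S(t)=\Pi(t)$ if $W^\pi(t)-W_{S(t-1)}(t)>g(W^\pi(t))$, and $S(t)=S(t-1)$ otherwise. **Theorem.** Suppose that for all admissible traffic with bounded arrivals and load less than one there is a constant $G<\infty$ such that,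 in the network operated by $\pi^g$, $\mathbb{E}[W^\pi(t)\mid L(t)]\ge W^*(t)-G$ for all $t$. Then $\pi^g$ is throughput optimal. -/

import Mathlib

open scoped NNReal ENNReal Topology BigOperators

noncomputable section

namespace OpticalSwitch

/-- Matrices of packet counts, indexed by (source, destination). -/
abbrev Packets (N : ℕ) : Type := Fin N → Fin N → ℕ

/-- A `0/1` matrix: `S i j = true` iff there is a circuit from `i` to `j`. -/
abbrev Circuits (N : ℕ) : Type := Fin N → Fin N → Bool

/-- The weight `⟨L, S⟩ = ∑ i, ∑ j, L i j * S i j` of a schedule for the queue lengths `L`. -/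
def weight {N : ℕ} (L : Packets N) (S : Circuits N) : ℕ :=
  ∑ i, ∑ j, L i j * (S i j).toNat

/-- The total queue length. -/
def total {N : ℕ} (L : Packets N) : ℕ := ∑ i, ∑ j, L i j

/-- The network: an arbitrary set of feasible schedules, the reconfiguration delay (in slots), and
the initial data, namely the schedule in force before slot `0` and the queue lengths at the
beginning of slot `0`. There is no queue from a switch to itself. -/
structure Network (N : ℕ) where
  feasible : Finset (Circuits N)
  delay : ℝ
  initSched : feasible
  initQueue : Packets N
  initQueue_self : ∀ i, initQueue i i = 0

/-- Feasible schedules. -/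
abbrev Network.Sched {N : ℕ} (net : Network N) : Type := net.feasible

/-- The maximum weight over the feasible schedules. -/
def Network.maxWeight {N : ℕ} (net : Network N) (L : Packets N) : ℕ :=
  Finset.univ.sup (fun S : net.Sched => weight L S.1)

/-- The state at the beginning of a slot `t`: the schedule `S (t - 1)`, the queue lengths `L t`, and
the number of slots from the latest reconfiguration to slot `t - 1` (`none` if there was none). -/
structure Network.State {N : ℕ} (net : Network N) where
  sched : net.Sched
  queue : Packets N
  age : Option ℕ

/-- The state before slot `0`. -/
def Network.init {N : ℕ} (net : Network N) : net.State :=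
  ⟨net.initSched, net.initQueue, none⟩

/-- The age of the latest reconfiguration in slot `t`, when `S` is the schedule in slot `t`: a
reconfiguration takes place in slot `t` iff the schedule differs from the previous one. -/
def Network.State.newAge {N : ℕ} {net : Network N} (x : net.State) (S : net.Sched) : Option ℕ :=
  open scoped Classical in if S = x.sched then x.age.map (· + 1) else some 0

/-- Slot `t` is blocked: `t = s + τ` with `0 ≤ τ ≤ delay`, where a reconfiguration took place in
slot `s`. (It suffices to look at the latest reconfiguration.) -/
def Network.State.Blocked {N : ℕ} {net : Network N} (x : net.State) (S : net.Sched) : Prop :=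
  ∃ τ : ℕ, x.newAge S = some τ ∧ (τ : ℝ) ≤ net.delay

/-- The departures in a slot with schedule `S`. -/
def Network.State.departures {N : ℕ} {net : Network N} (x : net.State) (S : net.Sched) :
    Packets N := fun i j =>
  open scoped Classical in
  if x.Blocked S then 0 else if 0 < x.queue i j then (S.1 i j).toNat else 0

/-- One slot with schedule `S` and arrivals `a` (which occur at the end of the slot). The truncated
subtraction is exact, since no more packets depart than are present. -/
def Network.State.next {N : ℕ} {net : Network N} (x : net.State) (S : net.Sched) (a : Packets N) :
    net.State :=
  ⟨S, fun i j => x.queue i j - x.departures S i j + a i j, x.newAge S⟩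

/-- Histories, latest slot first: the schedule and the arrivals of each past slot. -/
abbrev Network.History {N : ℕ} (net : Network N) : Type := List (net.Sched × Packets N)

/-- The state after a history. -/
def Network.stateOf {N : ℕ} (net : Network N) : net.History → net.State
  | [] => net.init
  | (S, a) :: h => (net.stateOf h).next S a

/-- Arrival traffic, given by the laws of the numbers of arrivals per slot at the queues: arrivals
are independent over the queues and i.i.d. over the slots. -/
structure Traffic (N : ℕ) where
  law : Fin N → Fin N → PMF ℕ
  law_self : ∀ i, law i i = PMF.pure 0

/-- The law of the matrix of arrivals in one slot (independent entries). -/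
def Traffic.slotLaw {N : ℕ} (A : Traffic N) : PMF (Packets N) :=
  (MeasureTheory.Measure.pi fun i => MeasureTheory.Measure.pi fun j => (A.law i j).toMeasure).toPMF

/-- The arrivals are bounded by a constant. -/
def Traffic.Bounded {N : ℕ} (A : Traffic N) : Prop :=
  ∃ Amax : ℕ, ∀ i j, ∀ n ∈ (A.law i j).support, n ≤ Amax

/-- The traffic rate matrix (only used for traffic with finite means). -/
def Traffic.rate {N : ℕ} (A : Traffic N) : Fin N → Fin N → ℝ≥0 := fun i j =>
  (∑' n : ℕ, A.law i j n * (n : ℝ≥0∞)).toNNReal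

/-- A (possibly randomized) scheduling policy: the schedule in slot `t` is drawn from a law that
depends on the schedules and arrivals in the slots before `t` and the arrivals in slot `t`. -/
abbrev Network.Policy {N : ℕ} (net : Network N) : Type :=
  net.History → Packets N → PMF net.Sched

/-- The law of the history of the slots before `t` under a policy. -/
def Network.historyLaw {N : ℕ} (net : Network N) (A : Traffic N) (P : net.Policy) :
    ℕ → PMF net.History
  | 0 => PMF.pure []
  | t + 1 => (net.historyLaw A P t).bind fun h => A.slotLaw.bind fun a =>
      (P h a).bind fun S => PMF.pure ((S, a) :: h)

/-- The expected total queue length at the beginning of slot `t`. -/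
def Network.meanTotal {N : ℕ} (net : Network N) (A : Traffic N) (P : net.Policy) (t : ℕ) : ℝ≥0∞ :=
  ∑' h, net.historyLaw A P t h * (total (net.stateOf h).queue : ℝ≥0∞)

/-- Strong stability of the network under a policy. -/
def Network.StronglyStable {N : ℕ} (net : Network N) (A : Traffic N) (P : net.Policy) : Prop :=
  Filter.limsup (fun t : ℕ => (∑ τ ∈ Finset.range t, net.meanTotal A P τ) / (t : ℝ≥0∞))
    Filter.atTop < ∞

/-- Traffic is admissible if some scheduling policy strongly stabilizes the network. -/
def Network.Admissible {N : ℕ} (net : Network N) (A : Traffic N) : Prop :=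
  ∃ P : net.Policy, net.StronglyStable A P

/-- The capacity region: the rate matrices of admissible traffic. -/
def Network.capacityRegion {N : ℕ} (net : Network N) : Set (Fin N → Fin N → ℝ≥0) :=
  {r | ∃ A : Traffic N, net.Admissible A ∧ A.rate = r}

/-- The load of the traffic: the infimum of the `r` in `(0, 1)` such that the rate matrix lies in
`r` times the closure of the capacity region (`∞` if there is no such `r`). -/
def Network.load {N : ℕ} (net : Network N) (A : Traffic N) : ℝ≥0∞ :=
  sInf {ρ | ∃ r : ℝ≥0, 0 < r ∧ r < 1 ∧ (∃ m ∈ closure net.capacityRegion, A.rate = r • m) ∧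
    ρ = (r : ℝ≥0∞)}

/-- The traffic under consideration: admissible, of load less than one, with bounded arrivals. -/
structure Network.Supports {N : ℕ} (net : Network N) (A : Traffic N) : Prop where
  bounded : A.Bounded
  admissible : net.Admissible A
  load_lt_one : net.load A < 1

/-- Throughput optimality of a policy (for bounded arrivals). -/
def Network.ThroughputOptimal {N : ℕ} (net : Network N) (P : net.Policy) : Prop :=
  ∀ A : Traffic N, net.Supports A → net.StronglyStable A P

/-- A randomized Markov policy: the law of the schedule in slot `t` as a function of `S (t - 1)` and
`L t`. -/
abbrev Network.MarkovPolicy {N : ℕ} (net : Network N) : Type :=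
  net.Sched → Packets N → PMF net.Sched

/-- A Markov policy as a scheduling policy. -/
def Network.MarkovPolicy.toPolicy {N : ℕ} {net : Network N} (p : net.MarkovPolicy) : net.Policy :=
  fun h _ => p (net.stateOf h).sched (net.stateOf h).queue

/-- Hysteresis functions; only their values on `[0, ∞)` matter. -/
structure IsHysteresis (g : ℝ → ℝ) : Prop where
  nonneg : ∀ x, 0 ≤ x → 0 ≤ g x
  continuousOn : ContinuousOn g (Set.Ici 0)
  strictMonoOn : StrictMonoOn g (Set.Ici 0)
  sublinear : Filter.Tendsto (fun x => g x / x) Filter.atTop (𝓝 0)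
  unbounded : Filter.Tendsto g Filter.atTop Filter.atTop

/-- The `g`-adaptive variant: draw a schedule from `p`; keep the previous schedule `S` unless the
weight of the drawn schedule exceeds that of `S` by more than the threshold. -/
def Network.MarkovPolicy.adaptive {N : ℕ} {net : Network N} (p : net.MarkovPolicy) (g : ℝ → ℝ) :
    net.MarkovPolicy := fun S L =>
  (p S L).map fun S' =>
    open scoped Classical in
    if (weight L S'.1 : ℝ) - (weight L S.1 : ℝ) ≤ g (weight L S'.1 : ℝ) then S else S'

/-- The expected weight of the schedule generated by `p` in the state `(S, L)`. -/
def Network.MarkovPolicy.meanWeight {N : ℕ} {net : Network N} (p : net.MarkovPolicy)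
    (S : net.Sched) (L : Packets N) : ℝ≥0∞ :=
  ∑' S', p S L S' * (weight L S'.1 : ℝ≥0∞)

/-- In the network operated by the policy `P`, the expected weight of the schedule that `p` generates
in slot `t`, conditioned on `L t`, is at least the maximum weight minus `G`, for all `t` and all
values `ℓ` that `L t` takes with positive probability. -/
def Network.ExpectedWeightBound {N : ℕ} (net : Network N) (A : Traffic N) (P : net.Policy)
    (p : net.MarkovPolicy) (G : ℝ≥0) : Prop :=
  ∀ (t : ℕ) (ℓ : Packets N)
    (hℓ : ∃ h ∈ {h : net.History | (net.stateOf h).queue = ℓ}, h ∈ (net.historyLaw A P t).support),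
    (net.maxWeight ℓ : ℝ≥0∞) ≤
      (∑' h, (net.historyLaw A P t).filter {h | (net.stateOf h).queue = ℓ} hℓ h *
        p.meanWeight (net.stateOf h).sched ℓ) + G

end OpticalSwitch

end

/-!
The proof is a drift argument for the Markov chain of the schedule in force, the queue lengths and
the age of the latest reconfiguration. Write `W` for the maximum weight.

*Slack.* Under any policy a weighted sum of the queue lengths grows in the mean at least at the
weighted arrival rate minus the maximum weight for these weights. So the rates of stabilizable
traffic lie in the closed region where this difference is never positive
(`Network.Admissible.sum_mul_rate_le`), and load less than one gives `∑ L * rate ≤ r * W` with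
`r < 1` (`Network.exists_sum_mul_rate_le`).

*Squared queue lengths.* Their drift is at most `2 * r * W`, minus twice the service, plus a
constant. The adaptive policy uses a schedule whose weight is at least that of the drawn schedule
minus the threshold, which is sublinear; so, outside blocked slots, the service misses `W` only by
the deficit of the drawn schedule and a small multiple of `W`.

*Reconfigurations.* It remains to see that the slots lost to reconfigurations carry a small fraction
of the total of `W`. They are paid for by reconfigurations (`Network.State.remaining_drift`), and
there are three kinds of these (`Network.State.reconfiguration_cost`). Those at age `M` or more carry
a fraction `1 / M` of the weight (`Network.State.cappedAge_drift`). Those from a schedule that had a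
deficit of more than `K` when it was chosen carry, by Markov's inequality, a fraction of order
`1 / K` (`Network.State.poorWeight_drift`). In the remaining case the current schedule is within a
constant of the optimum, weights changing by a bounded amount in a slot, so that the threshold can be
exceeded only if the drawn weight is bounded. Each of these accounts is kept by a potential, and
`Network.State.lyapunov` combines them into one function whose one-slot drift is
`Network.State.lyapunov_drift`.

*Means.* The hypothesis bounds the deficit conditionally on the queue lengths, hence also its mean
weighted by `W` (`Network.ExpectedWeightBound.expect_mul_meanDeficit_le`). For `M` and `K` large the
mean drift is at most a constant minus the mean of `W` (`Network.exists_mean_drift`); summation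
bounds the time averages of the mean of `W`. This bounds the queue lengths, since a queue that no
schedule serves has no arrivals (`Network.expect_queue_le`).

All means are taken in `[0, ∞]`, so that integrability matters only where a term is cancelled.
-/

noncomputable section

namespace OpticalSwitch

/-! ### Expectations under discrete laws -/

/-- The expectation of a `[0, ∞]`-valued function under a discrete law. -/
def expect {α : Type*} (p : PMF α) (f : α → ℝ≥0∞) : ℝ≥0∞ := ∑' x, p x * f x

section Expect

variable {α β : Type*}

lemma expect_pure (x : α) (f : α → ℝ≥0∞) : expect (PMF.pure x) f = f x := by
  unfold expect
  rw [tsum_eq_single x]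
  · simp
  · intro y hy
    simp [PMF.pure_apply, hy]

lemma expect_bind (p : PMF α) (q : α → PMF β) (f : β → ℝ≥0∞) :
    expect (p.bind q) f = expect p fun x => expect (q x) f := by
  unfold expect
  simp only [PMF.bind_apply, ← ENNReal.tsum_mul_left, ← ENNReal.tsum_mul_right]
  rw [ENNReal.tsum_comm]
  simp only [mul_assoc]

lemma expect_map (p : PMF α) (u : α → β) (f : β → ℝ≥0∞) :
    expect (p.map u) f = expect p fun x => f (u x) := by
  rw [PMF.map, expect_bind]
  simp only [Function.comp_apply, expect_pure]

lemma expect_add (p : PMF α) (f g : α → ℝ≥0∞) :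
    (expect p fun x => f x + g x) = expect p f + expect p g := by
  simp only [expect, mul_add, ENNReal.tsum_add]

lemma expect_const_mul (p : PMF α) (c : ℝ≥0∞) (f : α → ℝ≥0∞) :
    (expect p fun x => c * f x) = c * expect p f := by
  simp only [expect, ← ENNReal.tsum_mul_left, mul_left_comm]

lemma expect_const (p : PMF α) (c : ℝ≥0∞) : (expect p fun _ => c) = c := by
  simp [expect, ENNReal.tsum_mul_right, p.tsum_coe]

lemma expect_sum {ι : Type*} (s : Finset ι) (p : PMF α) (f : ι → α → ℝ≥0∞) :
    (expect p fun x => ∑ i ∈ s, f i x) = ∑ i ∈ s, expect p (f i) := by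
  simp only [expect, Finset.mul_sum]
  exact Summable.tsum_finsetSum fun _ _ => ENNReal.summable

lemma expect_mono_support {p : PMF α} {f g : α → ℝ≥0∞} (h : ∀ x, p x ≠ 0 → f x ≤ g x) :
    expect p f ≤ expect p g := by
  refine ENNReal.tsum_le_tsum fun x => ?_
  by_cases hx : p x = 0
  · simp [hx]
  · gcongr
    exact h x hx

lemma expect_mono {p : PMF α} {f g : α → ℝ≥0∞} (h : ∀ x, f x ≤ g x) :
    expect p f ≤ expect p g :=
  expect_mono_support fun x _ => h x

end Expect

/-! ### Arrivals and the law of the history -/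

variable {N : ℕ}

/-- The mean number of arrivals per slot at a queue, possibly infinite. -/
def Traffic.mean (A : Traffic N) (i j : Fin N) : ℝ≥0∞ := expect (A.law i j) fun n => (n : ℝ≥0∞)

lemma Traffic.coe_rate_le_mean (A : Traffic N) (i j : Fin N) :
    (A.rate i j : ℝ≥0∞) ≤ A.mean i j := ENNReal.coe_toNNReal_le_self

lemma Traffic.Bounded.coe_rate {A : Traffic N} (hA : A.Bounded) (i j : Fin N) :
    (A.rate i j : ℝ≥0∞) = A.mean i j := by
  obtain ⟨m, hm⟩ := hA
  refine ENNReal.coe_toNNReal (ne_top_of_le_ne_top (ENNReal.natCast_ne_top m) ?_)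
  change expect (A.law i j) _ ≤ _
  rw [← expect_const (A.law i j) (m : ℝ≥0∞)]
  refine expect_mono_support fun n hn => ?_
  exact_mod_cast hm i j n hn

lemma Traffic.slotLaw_apply (A : Traffic N) (a : Packets N) :
    A.slotLaw a = ∏ i, ∏ j, A.law i j (a i j) := by
  unfold Traffic.slotLaw
  rw [MeasureTheory.Measure.toPMF_apply, MeasureTheory.Measure.pi_singleton]
  simp only [MeasureTheory.Measure.pi_singleton]
  refine Finset.prod_congr rfl fun i _ => Finset.prod_congr rfl fun j _ => ?_
  exact PMF.toMeasure_apply_singleton _ _ (MeasurableSet.singleton _)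

lemma Traffic.law_ne_zero_of_slotLaw_ne_zero (A : Traffic N) {a : Packets N}
    (ha : A.slotLaw a ≠ 0) (i j : Fin N) : A.law i j (a i j) ≠ 0 := by
  rw [A.slotLaw_apply, Finset.prod_ne_zero_iff] at ha
  exact Finset.prod_ne_zero_iff.1 (ha i (Finset.mem_univ i)) j (Finset.mem_univ j)

lemma Traffic.expect_slotLaw_apply (A : Traffic N) (i j : Fin N) :
    (expect A.slotLaw fun a => (a i j : ℝ≥0∞)) = A.mean i j := by
  set μ : MeasureTheory.Measure (Packets N) :=
    MeasureTheory.Measure.pi fun i => MeasureTheory.Measure.pi fun j => (A.law i j).toMeasure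
  have h1 : (expect A.slotLaw fun a => (a i j : ℝ≥0∞)) = ∫⁻ a, (a i j : ℝ≥0∞) ∂μ := by
    rw [MeasureTheory.lintegral_countable']
    refine tsum_congr fun a => ?_
    rw [mul_comm]
    rfl
  have hm : Measurable fun n : ℕ => (n : ℝ≥0∞) := measurable_from_top
  have e1 := MeasureTheory.measurePreserving_eval
    (fun i => MeasureTheory.Measure.pi fun j => (A.law i j).toMeasure) i
  have e2 := MeasureTheory.measurePreserving_eval (fun j => (A.law i j).toMeasure) j
  have h2 : ∫⁻ a, (a i j : ℝ≥0∞) ∂μ = ∫⁻ n : ℕ, (n : ℝ≥0∞) ∂(A.law i j).toMeasure := by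
    rw [← (e2.comp e1).lintegral_comp hm]
    rfl
  rw [h1, h2, MeasureTheory.lintegral_countable', Traffic.mean, expect]
  refine tsum_congr fun n => ?_
  rw [mul_comm, PMF.toMeasure_apply_singleton _ _ (MeasurableSet.singleton _)]

/-- The mean of a function of the history after one more slot. -/
lemma Network.expect_historyLaw_succ (net : Network N) (A : Traffic N) (P : net.Policy) (t : ℕ)
    (f : net.History → ℝ≥0∞) :
    expect (net.historyLaw A P (t + 1)) f =
      expect (net.historyLaw A P t) fun h => expect A.slotLaw fun a => expect (P h a) fun S =>
        f ((S, a) :: h) := by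
  simp only [Network.historyLaw, expect_bind, expect_pure]

/-- Pairing of weights and packets. -/
def dot (w L : Packets N) : ℕ := ∑ i, ∑ j, w i j * L i j

/-- The mean of the weighted arrivals of a slot. -/
lemma Traffic.expect_slotLaw_dot (A : Traffic N) (w : Packets N) :
    (expect A.slotLaw fun a => (dot w a : ℝ≥0∞)) = ∑ i, ∑ j, (w i j : ℝ≥0∞) * A.mean i j := by
  simp only [dot, Nat.cast_sum, Nat.cast_mul, expect_sum, expect_const_mul, A.expect_slotLaw_apply]

/-! ### Necessary conditions on admissible rates -/

lemma Network.weight_le_maxWeight (net : Network N) (L : Packets N) (S : net.Sched) :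
    weight L S.1 ≤ net.maxWeight L :=
  Finset.le_sup (f := fun S : net.Sched => weight L S.1) (Finset.mem_univ S)

lemma Network.State.departures_le_toNat {net : Network N} (x : net.State) (S : net.Sched)
    (i j : Fin N) : x.departures S i j ≤ (S.1 i j).toNat := by
  unfold Network.State.departures
  split_ifs <;> simp

lemma Network.State.departures_le_queue {net : Network N} (x : net.State) (S : net.Sched)
    (i j : Fin N) : x.departures S i j ≤ x.queue i j := by
  unfold Network.State.departures
  have := Bool.toNat_le (S.1 i j)
  split_ifs <;> omega

/-- In one slot a weighted sum of the queue lengths falls at most by the maximum weight. -/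
lemma Network.dot_next_ge (net : Network N) (x : net.State) (S : net.Sched) (a w : Packets N) :
    dot w x.queue + dot w a ≤ dot w (x.next S a).queue + net.maxWeight w := by
  refine le_trans ?_ (Nat.add_le_add_left (net.weight_le_maxWeight w S) _)
  simp only [dot, weight, ← Finset.sum_add_distrib, ← mul_add]
  refine Finset.sum_le_sum fun i _ => Finset.sum_le_sum fun j _ => Nat.mul_le_mul_left _ ?_
  have := x.departures_le_toNat S i j
  simp only [Network.State.next]
  omega

/-- The mean weighted queue length grows at least linearly, at the weighted arrival rate minus the
maximum weight, whatever the policy. -/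
lemma Network.mul_le_expect_dot (net : Network N) (A : Traffic N) (P : net.Policy) (w : Packets N)
    (t : ℕ) :
    t * (∑ i, ∑ j, (w i j : ℝ≥0∞) * A.mean i j) ≤
      (expect (net.historyLaw A P t) fun h => (dot w (net.stateOf h).queue : ℝ≥0∞)) +
        t * net.maxWeight w := by
  induction t with
  | zero => simp
  | succ t ih =>
    set B := ∑ i, ∑ j, (w i j : ℝ≥0∞) * A.mean i j with hB
    have step : (expect (net.historyLaw A P t) fun h => (dot w (net.stateOf h).queue : ℝ≥0∞)) + B ≤
        (expect (net.historyLaw A P (t + 1)) fun h => (dot w (net.stateOf h).queue : ℝ≥0∞)) +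
          net.maxWeight w := by
      rw [net.expect_historyLaw_succ, ← expect_const (net.historyLaw A P t) B, ← expect_add,
        ← expect_const (net.historyLaw A P t) (net.maxWeight w : ℝ≥0∞), ← expect_add]
      refine expect_mono fun h => ?_
      rw [hB, ← A.expect_slotLaw_dot, ← expect_const A.slotLaw (dot w (net.stateOf h).queue : ℝ≥0∞),
        ← expect_add, ← expect_const A.slotLaw (net.maxWeight w : ℝ≥0∞), ← expect_add]
      refine expect_mono fun a => ?_
      rw [← expect_const (P h a) (net.maxWeight w : ℝ≥0∞), ← expect_add,
        ← expect_const (P h a) ((dot w (net.stateOf h).queue : ℝ≥0∞) + (dot w a : ℝ≥0∞))]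
      refine expect_mono fun S => ?_
      exact_mod_cast net.dot_next_ge (net.stateOf h) S a w
    push_cast
    calc (t + 1) * B = t * B + B := by ring
      _ ≤ _ := add_le_add_left ih B
      _ = ((expect (net.historyLaw A P t) fun h => (dot w (net.stateOf h).queue : ℝ≥0∞)) + B) +
          t * net.maxWeight w := by ring
      _ ≤ _ := add_le_add_left step _
      _ = _ := by ring

lemma dot_le_mul_total (w L : Packets N) : dot w L ≤ total w * total L := by
  unfold dot total
  rw [Finset.sum_mul]
  refine Finset.sum_le_sum fun i _ => ?_
  rw [Finset.sum_mul]
  refine Finset.sum_le_sum fun j _ => Nat.mul_le_mul_left _ ?_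
  exact (Finset.single_le_sum (f := fun j => L i j) (fun _ _ => Nat.zero_le _)
    (Finset.mem_univ j)).trans (Finset.single_le_sum (f := fun i => ∑ j, L i j)
      (fun _ _ => Nat.zero_le _) (Finset.mem_univ i))

/-- Admissible traffic has rates that no weighting separates from the schedules: otherwise the mean
queue lengths would grow linearly under every policy. -/
lemma Network.Admissible.sum_mul_rate_le {net : Network N} {A : Traffic N} (hA : net.Admissible A)
    (w : Packets N) : ∑ i, ∑ j, (w i j : ℝ≥0) * A.rate i j ≤ net.maxWeight w := by
  obtain ⟨P, hP⟩ := hA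
  by_contra! hlt
  set b : ℝ≥0 := ∑ i, ∑ j, (w i j : ℝ≥0) * A.rate i j with hb
  have hbmean : (b : ℝ≥0∞) ≤ ∑ i, ∑ j, (w i j : ℝ≥0∞) * A.mean i j := by
    rw [hb]
    push_cast
    exact Finset.sum_le_sum fun i _ => Finset.sum_le_sum fun j _ =>
      mul_le_mul_right (A.coe_rate_le_mean i j) _
  obtain ⟨η, hη, hbη⟩ : ∃ η : ℝ≥0, 0 < η ∧ b = net.maxWeight w + η :=
    ⟨b - net.maxWeight w, tsub_pos_of_lt hlt, (add_tsub_cancel_of_le hlt.le).symm⟩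
  -- The mean total queue length, up to a constant factor, is at least `t * η`.
  have hgrow : ∀ t : ℕ, (t : ℝ≥0∞) * η ≤ total w * net.meanTotal A P t := by
    intro t
    have h1 := (mul_le_mul_right hbmean (t : ℝ≥0∞)).trans (net.mul_le_expect_dot A P w t)
    have h2 : (expect (net.historyLaw A P t) fun h => (dot w (net.stateOf h).queue : ℝ≥0∞)) ≤
        total w * net.meanTotal A P t := by
      change _ ≤ _ * expect (net.historyLaw A P t) fun h => (total (net.stateOf h).queue : ℝ≥0∞)
      rw [← expect_const_mul]
      refine expect_mono fun h => ?_
      exact_mod_cast dot_le_mul_total _ _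
    rw [hbη] at h1
    push_cast at h1
    rw [mul_add, add_comm] at h1
    have hfin : (t : ℝ≥0∞) * net.maxWeight w ≠ ∞ :=
      ENNReal.mul_ne_top (ENNReal.natCast_ne_top t) (ENNReal.natCast_ne_top _)
    exact ((ENNReal.add_le_add_iff_right hfin).1 h1).trans h2
  -- Bounded Cesàro means of the mean total queue length contradict this.
  obtain ⟨c, hc, hcfin⟩ := exists_between hP
  have hev := Filter.eventually_lt_of_limsup_lt hc
  obtain ⟨T, hT⟩ := Filter.eventually_atTop.1 hev
  have hbound : ∀ t : ℕ, T + 1 ≤ t → ((t : ℝ≥0∞) - 1) * η ≤ 2 * (total w * c) := by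
    intro t ht
    have ht0 : (t : ℝ≥0∞) ≠ 0 := by
      have : t ≠ 0 := by omega
      exact_mod_cast this
    have htf : (t : ℝ≥0∞) ≠ ∞ := ENNReal.natCast_ne_top t
    have h1 : ∑ τ ∈ Finset.range t, net.meanTotal A P τ ≤ c * t :=
      (ENNReal.div_le_iff ht0 htf).1 (hT t (by omega)).le
    have h2 : ∑ τ ∈ Finset.range t, (τ : ℝ≥0∞) * η ≤ total w * (c * t) := by
      refine le_trans (Finset.sum_le_sum fun τ _ => hgrow τ) ?_
      rw [← Finset.mul_sum]
      gcongr
    have h3 : ((∑ τ ∈ Finset.range t, τ : ℕ) : ℝ≥0∞) * 2 = t * ((t : ℝ≥0∞) - 1) := by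
      have h := congrArg (Nat.cast (R := ℝ≥0∞)) (Finset.sum_range_id_mul_two t)
      rw [Nat.cast_mul, Nat.cast_mul] at h
      simpa using h
    rw [← ENNReal.mul_le_mul_iff_right ht0 htf]
    calc (t : ℝ≥0∞) * (((t : ℝ≥0∞) - 1) * η)
        = 2 * ∑ τ ∈ Finset.range t, (τ : ℝ≥0∞) * η := by
          rw [← mul_assoc, ← h3, ← Finset.sum_mul]
          push_cast
          ring
      _ ≤ 2 * (total w * (c * t)) := by gcongr
      _ = t * (2 * (total w * c)) := by ring
  have hη' : (η : ℝ≥0∞) ≠ 0 := by exact_mod_cast hη.ne'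
  have hq : 2 * (total w * c) / η ≠ ∞ :=
    ENNReal.div_ne_top (ENNReal.mul_ne_top (by simp)
      (ENNReal.mul_ne_top (ENNReal.natCast_ne_top _) hcfin.ne)) hη'
  obtain ⟨n, hn⟩ := ENNReal.exists_nat_gt hq
  have h := hbound (n + T + 1) (by omega)
  have h' : ((n + T : ℕ) : ℝ≥0∞) * η ≤ 2 * (total w * c) := by
    refine le_trans (le_of_eq ?_) h
    congr 1
    push_cast
    rw [ENNReal.add_sub_cancel_right ENNReal.one_ne_top]
  rw [← ENNReal.le_div_iff_mul_le (Or.inl hη') (Or.inl ENNReal.coe_ne_top)] at h'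
  refine absurd (hn.trans_le ?_) (not_lt.2 h')
  exact_mod_cast Nat.le_add_right n T

/-- Traffic of load less than one has slack: its rates lie in `r < 1` times the region cut out by
the maximum weights, which is closed and contains the capacity region. -/
lemma Network.exists_sum_mul_rate_le {net : Network N} {A : Traffic N} (hA : net.load A < 1) :
    ∃ r : ℝ≥0, r < 1 ∧ ∀ w : Packets N,
      ∑ i, ∑ j, (w i j : ℝ≥0) * A.rate i j ≤ r * net.maxWeight w := by
  obtain ⟨_, ⟨r, _, hr1, ⟨m, hm, hAm⟩, _⟩, _⟩ := sInf_lt_iff.1 hA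
  refine ⟨r, hr1, fun w => ?_⟩
  have hclosed : IsClosed {m : Fin N → Fin N → ℝ≥0 |
      ∑ i, ∑ j, (w i j : ℝ≥0) * m i j ≤ net.maxWeight w} :=
    isClosed_le (by fun_prop) continuous_const
  have hmem : m ∈ {m : Fin N → Fin N → ℝ≥0 |
      ∑ i, ∑ j, (w i j : ℝ≥0) * m i j ≤ net.maxWeight w} := by
    refine closure_minimal ?_ hclosed hm
    rintro _ ⟨B, hB, rfl⟩
    exact hB.sum_mul_rate_le w
  calc ∑ i, ∑ j, (w i j : ℝ≥0) * A.rate i j = r * ∑ i, ∑ j, (w i j : ℝ≥0) * m i j := by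
        simp only [hAm, Finset.mul_sum, Pi.smul_apply, smul_eq_mul, mul_left_comm]
    _ ≤ r * net.maxWeight w := mul_le_mul_right hmem r

/-! ### Weights and squared queue lengths in one slot -/

/-- A bound on the change of any weight in a slot in which at most `m` packets arrive at each
queue. -/
def slotChange (N m : ℕ) : ℕ := N * N * (m + 1)

lemma sum_sum_const (N c : ℕ) : ∑ _i : Fin N, ∑ _j : Fin N, c = N * N * c := by
  simp [mul_assoc]

section OneSlot

variable {net : Network N} (x : net.State) (S : net.Sched) {a : Packets N} {m : ℕ}

lemma Network.State.weight_next_le (ha : ∀ i j, a i j ≤ m) (T : Circuits N) :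
    weight (x.next S a).queue T ≤ weight x.queue T + slotChange N m := by
  unfold slotChange weight
  rw [← sum_sum_const, ← Finset.sum_add_distrib]
  refine Finset.sum_le_sum fun i _ => ?_
  rw [← Finset.sum_add_distrib]
  refine Finset.sum_le_sum fun j _ => ?_
  have h1 := ha i j
  have h2 := x.departures_le_queue S i j
  simp only [Network.State.next]
  cases T i j
  · simp
  · simp only [Bool.toNat_true, mul_one]
    omega

lemma Network.State.weight_le_weight_next (a : Packets N) (m : ℕ) (T : Circuits N) :
    weight x.queue T ≤ weight (x.next S a).queue T + slotChange N m := by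
  unfold slotChange weight
  rw [← sum_sum_const, ← Finset.sum_add_distrib]
  refine Finset.sum_le_sum fun i _ => ?_
  rw [← Finset.sum_add_distrib]
  refine Finset.sum_le_sum fun j _ => ?_
  have h2 := x.departures_le_toNat S i j
  have h3 := Bool.toNat_le (S.1 i j)
  simp only [Network.State.next]
  cases T i j
  · simp
  · simp only [Bool.toNat_true, mul_one]
    omega

lemma Network.State.maxWeight_next_le (ha : ∀ i j, a i j ≤ m) :
    net.maxWeight (x.next S a).queue ≤ net.maxWeight x.queue + slotChange N m :=
  Finset.sup_le fun T _ => (x.weight_next_le S ha T.1).trans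
    (Nat.add_le_add_right (net.weight_le_maxWeight x.queue T) _)

lemma Network.State.newAge_of_eq (h : S = x.sched) : x.newAge S = x.age.map (· + 1) :=
  if_pos h

lemma Network.State.newAge_of_ne (h : S ≠ x.sched) : x.newAge S = some 0 :=
  if_neg h

lemma Network.State.blocked_iff :
    x.Blocked S ↔ 0 ≤ net.delay ∧ ∃ τ, x.newAge S = some τ ∧ τ ≤ ⌊net.delay⌋₊ := by
  unfold Network.State.Blocked
  constructor
  · rintro ⟨τ, h, hτ⟩
    exact ⟨(Nat.cast_nonneg τ).trans hτ, τ, h, Nat.le_floor hτ⟩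
  · rintro ⟨h0, τ, h, hτ⟩
    exact ⟨τ, h, (Nat.le_floor_iff h0).1 hτ⟩

open scoped Classical in
/-- The service in one slot: the weight of the schedule, or zero if the slot is blocked. -/
def Network.State.service : ℕ := if x.Blocked S then 0 else weight x.queue S.1

open scoped Classical in
/-- The drift of the sum of the squared queue lengths. -/
lemma Network.State.dot_self_next_le (ha : ∀ i j, a i j ≤ m) :
    dot (x.next S a).queue (x.next S a).queue + 2 * x.service S ≤
      dot x.queue x.queue + 2 * dot x.queue a + N * N * (m + 1) ^ 2 := by
  have hserv : x.service S = ∑ i, ∑ j, x.queue i j * x.departures S i j := by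
    unfold Network.State.service weight
    by_cases hb : x.Blocked S
    · simp [hb, Network.State.departures]
    · rw [if_neg hb]
      refine Finset.sum_congr rfl fun i _ => Finset.sum_congr rfl fun j _ => ?_
      rcases Nat.eq_zero_or_pos (x.queue i j) with h0 | h0
      · simp [h0]
      · simp [Network.State.departures, hb, h0]
  rw [hserv, ← sum_sum_const]
  unfold dot
  simp only [Finset.mul_sum, ← Finset.sum_add_distrib]
  refine Finset.sum_le_sum fun i _ => Finset.sum_le_sum fun j _ => ?_
  have h1 := ha i j
  have h2 := x.departures_le_queue S i j
  have h3 := (x.departures_le_toNat S i j).trans (Bool.toNat_le _)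
  simp only [Network.State.next]
  generalize x.departures S i j = d at *
  generalize x.queue i j = q at *
  generalize a i j = b at *
  obtain ⟨q, rfl⟩ := Nat.exists_eq_add_of_le h2
  rw [Nat.add_sub_cancel_left]
  zify at *
  nlinarith

end OneSlot

/-! ### Potentials for blocked slots and reconfigurations -/

section Potentials

variable (net : Network N)

/-- The number of blocked slots that remain if there is no further reconfiguration. -/
def Network.remaining : Option ℕ → ℕ
  | none => 0
  | some k => ⌊net.delay⌋₊ - k

/-- The time since the latest reconfiguration, capped at `M`. -/
def cappedAge (M : ℕ) : Option ℕ → ℕ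
  | none => M
  | some k => min k M

/-- The current schedule was a poor choice: its weight is so far below the maximum weight that this
was already the case, by a margin of more than `K`, in the slot of the latest reconfiguration; `c`
bounds the change of a weight in one slot. -/
def Network.State.Poor {net : Network N} (K c : ℕ) (x : net.State) : Prop :=
  ∃ k, x.age = some k ∧ weight x.queue x.sched.1 + K + 2 * c * (k + 1) < net.maxWeight x.queue

open scoped Classical in
/-- The maximum weight if the current schedule was a poor choice, and zero otherwise. -/
def Network.State.poorWeight {net : Network N} (K c : ℕ) (x : net.State) : ℕ :=
  if x.Poor K c then net.maxWeight x.queue else 0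

variable {net} (x : net.State) (S : net.Sched) {a : Packets N} {m : ℕ}

open scoped Classical in
/-- The maximum weight pays for a blocked slot out of the remaining-time potential, which is filled
up by reconfigurations only. -/
lemma Network.State.remaining_drift (ha : ∀ i j, a i j ≤ m) :
    net.maxWeight (x.next S a).queue * net.remaining (x.next S a).age +
        (if x.Blocked S then net.maxWeight x.queue else 0) ≤
      net.maxWeight x.queue * net.remaining x.age +
        (⌊net.delay⌋₊ + 1) * (if S = x.sched then 0 else net.maxWeight x.queue) +
        slotChange N m * ⌊net.delay⌋₊ := by
  have hW := x.maxWeight_next_le S ha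
  have hage : (x.next S a).age = x.newAge S := rfl
  rw [hage]
  generalize net.maxWeight (x.next S a).queue = W' at *
  generalize net.maxWeight x.queue = W at *
  generalize slotChange N m = c at *
  by_cases hS : S = x.sched
  · have hB := x.blocked_iff S
    rw [x.newAge_of_eq S hS] at hB ⊢
    rw [if_pos hS]
    rcases hx : x.age with _ | k
    · have : ¬ x.Blocked S := by simp [hB, hx]
      simp [this, Network.remaining]
    · simp only [hx, Option.map_some, Option.some.injEq, exists_eq_left'] at hB
      simp only [Option.map_some, Network.remaining]
      by_cases hk : k + 1 ≤ ⌊net.delay⌋₊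
      · obtain ⟨d, hd⟩ := Nat.exists_eq_add_of_le hk
        have e1 : ⌊net.delay⌋₊ - (k + 1) = d := by omega
        have e2 : ⌊net.delay⌋₊ - k = d + 1 := by omega
        have hle : (if x.Blocked S then W else 0) ≤ W := by split_ifs <;> simp
        rw [e1, e2]
        have h1 : W' * d ≤ (W + c) * d := Nat.mul_le_mul_right d hW
        have h2 : c * d ≤ c * ⌊net.delay⌋₊ := Nat.mul_le_mul_left c (by omega)
        nlinarith
      · have : ¬ x.Blocked S := fun h => hk (hB.1 h).2
        have e1 : ⌊net.delay⌋₊ - (k + 1) = 0 := by omega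
        simp [this, e1]
  · rw [x.newAge_of_ne S hS, if_neg hS]
    have hle : (if x.Blocked S then W else 0) ≤ W := by split_ifs <;> simp
    simp only [Network.remaining, Nat.sub_zero]
    have h1 := Nat.mul_le_mul_right ⌊net.delay⌋₊ hW
    nlinarith [Nat.zero_le (W * (⌊net.delay⌋₊ - 0)), Nat.zero_le (W * net.remaining x.age)]

open scoped Classical in
/-- A reconfiguration empties the age potential, which gains at most the maximum weight per slot:
reconfigurations at age `M` or more account for a fraction `1 / M` of the weight. -/
lemma Network.State.cappedAge_drift (ha : ∀ i j, a i j ≤ m) (M : ℕ) :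
    net.maxWeight (x.next S a).queue * cappedAge M (x.next S a).age +
        (if S = x.sched then 0 else net.maxWeight x.queue * cappedAge M x.age) ≤
      net.maxWeight x.queue * cappedAge M x.age + net.maxWeight x.queue + slotChange N m * M := by
  have hW := x.maxWeight_next_le S ha
  have hage : (x.next S a).age = x.newAge S := rfl
  rw [hage]
  generalize net.maxWeight (x.next S a).queue = W' at *
  generalize net.maxWeight x.queue = W at *
  generalize slotChange N m = c at *
  by_cases hS : S = x.sched
  · rw [x.newAge_of_eq S hS, if_pos hS]
    have h1 : cappedAge M (x.age.map (· + 1)) ≤ cappedAge M x.age + 1 := by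
      rcases x.age with _ | k <;> simp [cappedAge]
      omega
    have h2 : cappedAge M (x.age.map (· + 1)) ≤ M := by
      rcases x.age with _ | k <;> simp [cappedAge]
    calc _ ≤ (W + c) * cappedAge M (x.age.map (· + 1)) := Nat.mul_le_mul_right _ hW
      _ = W * cappedAge M (x.age.map (· + 1)) + c * cappedAge M (x.age.map (· + 1)) := by ring
      _ ≤ W * (cappedAge M x.age + 1) + c * M :=
        add_le_add (Nat.mul_le_mul_left _ h1) (Nat.mul_le_mul_left _ h2)
      _ = _ := by ring
  · rw [x.newAge_of_ne S hS, if_neg hS]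
    simp only [cappedAge, Nat.zero_min, mul_zero]
    omega

open scoped Classical in
/-- A reconfiguration from a poor schedule empties the potential `poorWeight`, and only
reconfigurations to a poor schedule fill it. -/
lemma Network.State.poorWeight_drift (ha : ∀ i j, a i j ≤ m) (K : ℕ) {T : net.Sched}
    (hST : S = x.sched ∨ S = T) :
    K * (x.next S a).poorWeight K (slotChange N m) +
        K * (if S = x.sched then 0 else x.poorWeight K (slotChange N m)) ≤
      K * x.poorWeight K (slotChange N m) + K * slotChange N m +
        net.maxWeight x.queue * (net.maxWeight x.queue - weight x.queue T.1) := by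
  have hW := x.maxWeight_next_le S ha
  have hw := x.weight_le_weight_next S a m S.1
  by_cases hS : S = x.sched
  · rw [if_pos hS]
    have hpoor : (x.next S a).Poor K (slotChange N m) → x.Poor K (slotChange N m) := by
      rintro ⟨k, hk, hlt⟩
      have hk' : x.age.map (· + 1) = some k := (x.newAge_of_eq S hS).symm.trans hk
      obtain ⟨l, hl, rfl⟩ := Option.map_eq_some_iff.1 hk'
      refine ⟨l, hl, ?_⟩
      have hsched : (x.next S a).sched = S := rfl
      rw [hsched] at hlt
      rw [← hS]
      nlinarith
    have : (x.next S a).poorWeight K (slotChange N m) ≤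
        x.poorWeight K (slotChange N m) + slotChange N m := by
      unfold Network.State.poorWeight
      by_cases h : (x.next S a).Poor K (slotChange N m)
      · rw [if_pos h, if_pos (hpoor h)]
        exact hW
      · simp [h]
    nlinarith [Nat.mul_le_mul_left K this, Nat.zero_le (net.maxWeight x.queue *
      (net.maxWeight x.queue - weight x.queue T.1))]
  · obtain rfl := hST.resolve_left hS
    rw [if_neg hS]
    have : K * (x.next S a).poorWeight K (slotChange N m) ≤ K * slotChange N m +
        net.maxWeight x.queue * (net.maxWeight x.queue - weight x.queue S.1) := by
      unfold Network.State.poorWeight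
      by_cases h : (x.next S a).Poor K (slotChange N m)
      · rw [if_pos h]
        obtain ⟨k, hk, hlt⟩ := h
        have hk' : some 0 = some k := (x.newAge_of_ne S hS).symm.trans hk
        obtain rfl := Option.some.inj hk'
        have hsched : (x.next S a).sched = S := rfl
        rw [hsched] at hlt
        have hK : K ≤ net.maxWeight x.queue - weight x.queue S.1 := by omega
        have h1 := Nat.mul_le_mul_left (net.maxWeight x.queue) hK
        have h2 := Nat.mul_le_mul_left K hW
        nlinarith
      · simp [h]
    omega

end Potentials

/-! ### Drift under the adaptive policy, for given arrivals and a given draw -/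

section Adaptive

open scoped Classical in
/-- The schedule that the `g`-adaptive policy uses: the previous schedule `S`, unless the weight of
the drawn schedule `T` exceeds that of `S` by more than the threshold. -/
def Network.hysteresis {net : Network N} (g : ℝ → ℝ) (L : Packets N) (S T : net.Sched) :
    net.Sched :=
  if (weight L T.1 : ℝ) - (weight L S.1 : ℝ) ≤ g (weight L T.1 : ℝ) then S else T

lemma Network.MarkovPolicy.adaptive_eq {net : Network N} (p : net.MarkovPolicy) (g : ℝ → ℝ)
    (S : net.Sched) (L : Packets N) : p.adaptive g S L = (p S L).map (net.hysteresis g L S) :=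
  rfl

variable {net : Network N} {g : ℝ → ℝ} (x : net.State) (T : net.Sched)

lemma Network.hysteresis_eq_or (L : Packets N) (S T : net.Sched) :
    net.hysteresis g L S T = S ∨ net.hysteresis g L S T = T := by
  unfold Network.hysteresis
  split_ifs <;> simp

lemma Network.weight_sub_le_of_hysteresis (hg : ∀ y : ℝ, 0 ≤ y → 0 ≤ g y) (L : Packets N)
    (S T : net.Sched) : (weight L T.1 : ℝ) - g (weight L T.1 : ℝ) ≤
      weight L (net.hysteresis g L S T).1 := by
  unfold Network.hysteresis
  split_ifs with h
  · linarith
  · linarith [hg (weight L T.1 : ℝ) (Nat.cast_nonneg _)]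

lemma Network.lt_of_hysteresis_ne {L : Packets N} {S T : net.Sched}
    (h : net.hysteresis g L S T ≠ S) :
    g (weight L T.1 : ℝ) < (weight L T.1 : ℝ) - weight L S.1 := by
  unfold Network.hysteresis at h
  split_ifs at h with h'
  · exact absurd rfl h
  · exact not_le.1 h'

open scoped Classical in
/-- The weight lost in a slot: the service is the maximum weight up to the loss of a blocked slot,
the deficit of the drawn schedule, and a small fraction of the weight due to the threshold. -/
lemma Network.State.maxWeight_le_service (hg : ∀ y : ℝ, 0 ≤ y → 0 ≤ g y) {M C : ℕ}
    (hM : ∀ y : ℕ, M * g y ≤ y + C) :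
    M * net.maxWeight x.queue ≤
      M * x.service (net.hysteresis g x.queue x.sched T) +
      M * (if x.Blocked (net.hysteresis g x.queue x.sched T) then net.maxWeight x.queue else 0) +
      M * (net.maxWeight x.queue - weight x.queue T.1) + net.maxWeight x.queue + C := by
  unfold Network.State.service
  by_cases hB : x.Blocked (net.hysteresis g x.queue x.sched T)
  · rw [if_pos hB, if_pos hB]
    nlinarith
  · rw [if_neg hB, if_neg hB]
    have h1 := Network.weight_sub_le_of_hysteresis hg x.queue x.sched T
    have h2 := hM (weight x.queue T.1)
    have hT := net.weight_le_maxWeight x.queue T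
    obtain ⟨d, hd⟩ := Nat.exists_eq_add_of_le hT
    rw [hd, Nat.add_sub_cancel_left]
    have h3 := mul_le_mul_of_nonneg_left h1 (Nat.cast_nonneg (α := ℝ) M)
    rw [← Nat.cast_le (α := ℝ)]
    push_cast
    nlinarith [Nat.cast_nonneg (α := ℝ) d]

open scoped Classical in
/-- Every reconfiguration takes place at a large age, or from a poor schedule, or when the maximum
weight is bounded, up to the deficit of the drawn schedule: a schedule that was nearly optimal less
than `M` slots ago still is, so that the threshold is exceeded only at small weights. -/
lemma Network.State.reconfiguration_cost {M K c X : ℕ}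
    (hX : ∀ y : ℕ, X < y → ((K + 2 * c * M : ℕ) : ℝ) ≤ g y) :
    M * (if net.hysteresis g x.queue x.sched T = x.sched then 0 else net.maxWeight x.queue) ≤
      (if net.hysteresis g x.queue x.sched T = x.sched then 0
        else net.maxWeight x.queue * cappedAge M x.age) +
      M * (if net.hysteresis g x.queue x.sched T = x.sched then 0 else x.poorWeight K c) +
      M * (X + (net.maxWeight x.queue - weight x.queue T.1)) := by
  by_cases hS : net.hysteresis g x.queue x.sched T = x.sched
  · simp [hS]
  simp only [if_neg hS]
  by_cases hage : M ≤ cappedAge M x.age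
  · nlinarith [Nat.mul_le_mul_left (net.maxWeight x.queue) hage]
  by_cases hpoor : x.Poor K c
  · rw [Network.State.poorWeight, if_pos hpoor]
    nlinarith
  obtain ⟨k, hk, hkM⟩ : ∃ k, x.age = some k ∧ k + 1 ≤ M := by
    rcases hx : x.age with _ | k
    · simp [hx, cappedAge] at hage
    · simp only [hx, cappedAge] at hage
      exact ⟨k, rfl, by omega⟩
  have hle : net.maxWeight x.queue ≤ weight x.queue x.sched.1 + K + 2 * c * (k + 1) :=
    not_lt.1 fun h => hpoor ⟨k, hk, h⟩
  have hle' := Nat.mul_le_mul_left (2 * c) hkM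
  have hT := net.weight_le_maxWeight x.queue T
  have hTX : weight x.queue T.1 ≤ X := by
    by_contra! hlt
    have h1 := hX _ hlt
    have h2 := Network.lt_of_hysteresis_ne hS
    have h3 : (weight x.queue x.sched.1 : ℝ) + (K + 2 * c * M : ℕ) < weight x.queue T.1 := by
      linarith
    have h4 : weight x.queue x.sched.1 + (K + 2 * c * M) < weight x.queue T.1 := by
      exact_mod_cast h3
    omega
  have : net.maxWeight x.queue ≤ X + (net.maxWeight x.queue - weight x.queue T.1) := by omega
  exact (Nat.mul_le_mul_left M this).trans (Nat.le_add_left _ _)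

/-- The Lyapunov function: the sum of the squared queue lengths, corrected by the potentials that
pay for blocked slots and for reconfigurations. It is scaled so as to be integral. -/
def Network.State.lyapunov (M K c : ℕ) (x : net.State) : ℕ :=
  M * K * dot x.queue x.queue +
  2 * M * K * (net.maxWeight x.queue * net.remaining x.age) +
  2 * (⌊net.delay⌋₊ + 1) * K * (net.maxWeight x.queue * cappedAge M x.age) +
  2 * (⌊net.delay⌋₊ + 1) * M * K * x.poorWeight K c

/-- The drift of the Lyapunov function in one slot, for given arrivals `a` and a given drawn
schedule `T`. -/
lemma Network.State.lyapunov_drift (hg : ∀ y : ℝ, 0 ≤ y → 0 ≤ g y) {M K C X m : ℕ}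
    (hM : ∀ y : ℕ, M * g y ≤ y + C)
    (hX : ∀ y : ℕ, X < y → ((K + 2 * slotChange N m * M : ℕ) : ℝ) ≤ g y)
    {a : Packets N} (ha : ∀ i j, a i j ≤ m) :
    (x.next (net.hysteresis g x.queue x.sched T) a).lyapunov M K (slotChange N m) +
        2 * M * K * net.maxWeight x.queue ≤
      x.lyapunov M K (slotChange N m) + 2 * M * K * dot x.queue a +
        2 * (⌊net.delay⌋₊ + 2) * K * net.maxWeight x.queue +
        2 * (⌊net.delay⌋₊ + 1) * M *
          (net.maxWeight x.queue * (net.maxWeight x.queue - weight x.queue T.1)) +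
        2 * (⌊net.delay⌋₊ + 2) * M * K * (net.maxWeight x.queue - weight x.queue T.1) +
        (M * K * (N * N * (m + 1) ^ 2) + 2 * M * K * (slotChange N m * ⌊net.delay⌋₊) +
          2 * (⌊net.delay⌋₊ + 1) * K * (slotChange N m * M) +
          2 * (⌊net.delay⌋₊ + 1) * M * (K * slotChange N m) +
          2 * (⌊net.delay⌋₊ + 1) * K * (M * X) + 2 * K * C) := by
  classical
  have h1 := x.dot_self_next_le (net.hysteresis g x.queue x.sched T) ha
  have h2 := x.remaining_drift (net.hysteresis g x.queue x.sched T) ha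
  have h3 := x.cappedAge_drift (net.hysteresis g x.queue x.sched T) ha M
  have h4 := x.poorWeight_drift (net.hysteresis g x.queue x.sched T) ha K
    (Network.hysteresis_eq_or x.queue x.sched T)
  have h5 := x.reconfiguration_cost T hX
  have h6 := x.maxWeight_le_service T hg hM
  unfold Network.State.lyapunov
  generalize (if net.hysteresis g x.queue x.sched T = x.sched then 0
    else net.maxWeight x.queue) = Wr at *
  generalize (if net.hysteresis g x.queue x.sched T = x.sched then 0
    else net.maxWeight x.queue * cappedAge M x.age) = Wo at *
  generalize (if net.hysteresis g x.queue x.sched T = x.sched then 0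
    else x.poorWeight K (slotChange N m)) = Wp at *
  generalize (if x.Blocked (net.hysteresis g x.queue x.sched T) then net.maxWeight x.queue
    else 0) = Wb at *
  generalize net.maxWeight x.queue - weight x.queue T.1 = d at *
  zify at *
  linear_combination (M * K : ℤ) * h1 + (2 * M * K : ℤ) * h2 +
    (2 * (⌊net.delay⌋₊ + 1) * K : ℤ) * h3 + (2 * (⌊net.delay⌋₊ + 1) * M : ℤ) * h4 +
    (2 * (⌊net.delay⌋₊ + 1) * K : ℤ) * h5 + (2 * K : ℤ) * h6

end Adaptive

/-! ### Growth of the threshold function -/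

section Hysteresis

variable {g : ℝ → ℝ}

lemma IsHysteresis.exists_mul_le (hg : IsHysteresis g) (M : ℕ) :
    ∃ C : ℕ, ∀ y : ℕ, M * g y ≤ y + C := by
  have h1 : ∀ᶠ x : ℝ in Filter.atTop, g x / x < 1 / (M + 1) :=
    hg.sublinear.eventually (gt_mem_nhds (by positivity))
  obtain ⟨b, hb⟩ := Filter.eventually_atTop.1 h1
  have hb0 : (0 : ℝ) ≤ max b 1 := zero_le_one.trans (le_max_right _ _)
  obtain ⟨C, hC⟩ := exists_nat_ge (M * g (max b 1))
  refine ⟨C, fun y => ?_⟩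
  have hy0 : (0 : ℝ) ≤ y := Nat.cast_nonneg y
  have hM0 : (0 : ℝ) ≤ M := Nat.cast_nonneg M
  rcases le_total (y : ℝ) (max b 1) with hy | hy
  · have := mul_le_mul_of_nonneg_left (hg.strictMonoOn.monotoneOn hy0 hb0 hy) hM0
    linarith
  · have hpos : (0 : ℝ) < y := zero_lt_one.trans_le ((le_max_right _ _).trans hy)
    have h2 := hb y ((le_max_left _ _).trans hy)
    rw [div_lt_div_iff₀ hpos (by positivity)] at h2
    nlinarith [hg.nonneg y hy0, Nat.cast_nonneg (α := ℝ) C]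

lemma IsHysteresis.exists_forall_le (hg : IsHysteresis g) (b : ℝ) :
    ∃ X : ℕ, ∀ y : ℕ, X < y → b ≤ g y := by
  obtain ⟨X, hX⟩ := Filter.eventually_atTop.1
    ((hg.unbounded.comp tendsto_natCast_atTop_atTop).eventually_ge_atTop b)
  exact ⟨X, fun y hy => hX y hy.le⟩

end Hysteresis

/-! ### The deficit of the drawn schedule in the mean -/

section Conditional

variable {net : Network N}

/-- The expected deficit of the weight of the schedule drawn from `p`. -/
def Network.MarkovPolicy.meanDeficit (p : net.MarkovPolicy) (S : net.Sched) (L : Packets N) :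
    ℝ≥0∞ :=
  expect (p S L) fun T => ((net.maxWeight L - weight L T.1 : ℕ) : ℝ≥0∞)

lemma Network.MarkovPolicy.meanWeight_add_meanDeficit (p : net.MarkovPolicy) (S : net.Sched)
    (L : Packets N) : p.meanWeight S L + p.meanDeficit S L = net.maxWeight L := by
  change expect (p S L) (fun T => (weight L T.1 : ℝ≥0∞)) + _ = _
  rw [Network.MarkovPolicy.meanDeficit, ← expect_add,
    ← expect_const (p S L) (net.maxWeight L : ℝ≥0∞)]
  congr 1
  funext T
  exact_mod_cast Nat.add_sub_cancel' (net.weight_le_maxWeight L T)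

/-- The bound on the conditional mean weight given the queue lengths, in terms of the restriction of
the law to the histories that lead to the queue lengths `ℓ`. -/
lemma Network.ExpectedWeightBound.tsum_indicator_le {A : Traffic N} {P : net.Policy}
    {p : net.MarkovPolicy} {G : ℝ≥0} (h : net.ExpectedWeightBound A P p G) (t : ℕ)
    (ℓ : Packets N) :
    ∑' k, {k | (net.stateOf k).queue = ℓ}.indicator (net.historyLaw A P t) k *
        p.meanDeficit (net.stateOf k).sched ℓ ≤
      G * ∑' k, {k | (net.stateOf k).queue = ℓ}.indicator (net.historyLaw A P t) k := by
  set s : Set net.History := {k | (net.stateOf k).queue = ℓ}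
  set q := net.historyLaw A P t
  set Z := ∑' k, s.indicator q k with hZ
  by_cases hs : ∃ k ∈ s, k ∈ q.support
  · have hb := h t ℓ hs
    simp only [PMF.filter_apply] at hb
    have hZ0 : Z ≠ 0 := by
      obtain ⟨k, hk, hkq⟩ := hs
      intro h0
      have := ENNReal.tsum_eq_zero.1 h0 k
      rw [Set.indicator_of_mem hk] at this
      exact hkq this
    have hZ1 : Z ≤ 1 := by
      rw [← q.tsum_coe]
      exact ENNReal.tsum_le_tsum fun k => Set.indicator_le_self s q k
    have hZf : Z ≠ ∞ := ne_top_of_le_ne_top ENNReal.one_ne_top hZ1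
    set w := ∑' k, s.indicator q k * p.meanWeight (net.stateOf k).sched ℓ with hw
    set d := ∑' k, s.indicator q k * p.meanDeficit (net.stateOf k).sched ℓ with hd
    have hsum : w + d = Z * net.maxWeight ℓ := by
      rw [hw, hd, ← ENNReal.tsum_add, hZ, ← ENNReal.tsum_mul_right]
      simp only [← mul_add, p.meanWeight_add_meanDeficit]
    have hwf : w ≠ ∞ := by
      refine ne_top_of_le_ne_top (ENNReal.mul_ne_top hZf (ENNReal.natCast_ne_top _))
        (le_self_add.trans hsum.le)
    have hb' : Z * net.maxWeight ℓ ≤ w + G * Z := by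
      calc Z * net.maxWeight ℓ ≤ Z * (Z⁻¹ * w + G) := by
            refine mul_le_mul_right (hb.trans_eq ?_) Z
            rw [hw, ← ENNReal.tsum_mul_left]
            congr 1
            refine tsum_congr fun k => ?_
            rw [mul_comm _ (∑' a, s.indicator (⇑q) a)⁻¹, mul_assoc]
        _ = w + G * Z := by
            rw [mul_add, ← mul_assoc, ENNReal.mul_inv_cancel hZ0 hZf, one_mul, mul_comm Z]
    rw [← hsum] at hb'
    exact (ENNReal.add_le_add_iff_left hwf).1 hb'
  · have h0 : ∀ k, s.indicator q k = 0 := by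
      intro k
      by_cases hk : k ∈ s
      · rw [Set.indicator_of_mem hk]
        by_contra hne
        exact hs ⟨k, hk, hne⟩
      · exact Set.indicator_of_notMem hk q
    simp [h0]

/-- The mean deficit is at most `G`, also when weighted by a function of the queue lengths. -/
lemma Network.ExpectedWeightBound.expect_mul_meanDeficit_le {A : Traffic N} {P : net.Policy}
    {p : net.MarkovPolicy} {G : ℝ≥0} (h : net.ExpectedWeightBound A P p G) (t : ℕ)
    (f : Packets N → ℝ≥0∞) :
    (expect (net.historyLaw A P t) fun k => f (net.stateOf k).queue *
        p.meanDeficit (net.stateOf k).sched (net.stateOf k).queue) ≤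
      G * expect (net.historyLaw A P t) fun k => f (net.stateOf k).queue := by
  -- Any mean is the sum, over the values `ℓ` of the queue lengths, of restricted means.
  have key : ∀ φ : net.History → Packets N → ℝ≥0∞,
      (expect (net.historyLaw A P t) fun k => φ k (net.stateOf k).queue) =
        ∑' ℓ, ∑' k, {k | (net.stateOf k).queue = ℓ}.indicator (net.historyLaw A P t) k *
          φ k ℓ := by
    intro φ
    rw [ENNReal.tsum_comm]
    refine tsum_congr fun k => ?_
    rw [tsum_eq_single (net.stateOf k).queue]
    · rw [Set.indicator_of_mem (by rfl)]
    · intro ℓ hℓ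
      rw [Set.indicator_of_notMem (by exact fun h => hℓ h.symm), zero_mul]
  rw [key fun k ℓ => f ℓ * p.meanDeficit (net.stateOf k).sched ℓ, key fun _ ℓ => f ℓ,
    ← ENNReal.tsum_mul_left]
  refine ENNReal.tsum_le_tsum fun ℓ => ?_
  have := mul_le_mul_right (h.tsum_indicator_le t ℓ) (f ℓ)
  calc _ = f ℓ * ∑' k, {k | (net.stateOf k).queue = ℓ}.indicator (net.historyLaw A P t) k *
          p.meanDeficit (net.stateOf k).sched ℓ := by
        rw [← ENNReal.tsum_mul_left]
        exact tsum_congr fun k => mul_left_comm _ _ _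
    _ ≤ _ := this
    _ = _ := by
        rw [ENNReal.tsum_mul_right]
        ring

end Conditional

/-! ### Mean drift of the Lyapunov function -/

section MeanDrift

variable {net : Network N} {A : Traffic N}

/-- The mean of the maximum weight at the beginning of slot `t`. -/
def Network.meanMaxWeight (net : Network N) (A : Traffic N) (P : net.Policy) (t : ℕ) : ℝ≥0∞ :=
  expect (net.historyLaw A P t) fun h => (net.maxWeight (net.stateOf h).queue : ℝ≥0∞)

lemma Traffic.le_of_slotLaw_ne_zero {m : ℕ} (hm : ∀ i j, ∀ n ∈ (A.law i j).support, n ≤ m)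
    {a : Packets N} (ha : A.slotLaw a ≠ 0) (i j : Fin N) : a i j ≤ m :=
  hm i j _ (A.law_ne_zero_of_slotLaw_ne_zero ha i j)

lemma Network.meanMaxWeight_ne_top (hA : A.Bounded) (P : net.Policy) (t : ℕ) :
    net.meanMaxWeight A P t ≠ ∞ := by
  obtain ⟨m, hm⟩ := hA
  induction t with
  | zero => simp [Network.meanMaxWeight, Network.historyLaw, expect_pure]
  | succ t ih =>
    refine ne_top_of_le_ne_top (b := net.meanMaxWeight A P t + slotChange N m)
      (ENNReal.add_ne_top.2 ⟨ih, ENNReal.natCast_ne_top _⟩) ?_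
    unfold Network.meanMaxWeight
    rw [net.expect_historyLaw_succ,
      ← expect_const (net.historyLaw A P t) (slotChange N m : ℝ≥0∞), ← expect_add]
    refine expect_mono fun h => ?_
    rw [← expect_const A.slotLaw ((net.maxWeight (net.stateOf h).queue : ℝ≥0∞) + _)]
    refine expect_mono_support fun a ha => ?_
    rw [← expect_const (P h a) ((net.maxWeight (net.stateOf h).queue : ℝ≥0∞) + _)]
    refine expect_mono fun S => ?_
    exact_mod_cast (net.stateOf h).maxWeight_next_le S (Traffic.le_of_slotLaw_ne_zero hm ha)

/-- The slot dynamics under the adaptive policy: independent arrivals and a schedule drawn from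
`p`. -/
lemma Network.expect_historyLaw_adaptive_succ (p : net.MarkovPolicy) (g : ℝ → ℝ) (t : ℕ)
    (f : net.State → ℝ≥0∞) :
    (expect (net.historyLaw A (p.adaptive g).toPolicy (t + 1)) fun h => f (net.stateOf h)) =
      expect (net.historyLaw A (p.adaptive g).toPolicy t) fun h => expect A.slotLaw fun a =>
        expect (p (net.stateOf h).sched (net.stateOf h).queue) fun T =>
          f ((net.stateOf h).next
            (net.hysteresis g (net.stateOf h).queue (net.stateOf h).sched T) a) := by
  rw [net.expect_historyLaw_succ]
  simp only [Network.MarkovPolicy.toPolicy, Network.MarkovPolicy.adaptive_eq, expect_map,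
    Network.stateOf]

/-- Negative drift: for suitable parameters, the mean of the Lyapunov function falls in each slot by
the mean maximum weight, up to a constant. -/
lemma Network.exists_mean_drift {g : ℝ → ℝ} (hg : IsHysteresis g) {p : net.MarkovPolicy}
    {G : ℝ≥0} (hA : A.Bounded) (hload : net.load A < 1)
    (hG : net.ExpectedWeightBound A (p.adaptive g).toPolicy p G) :
    ∃ (F : net.State → ℕ) (C : ℝ≥0), ∀ t,
      (expect (net.historyLaw A (p.adaptive g).toPolicy (t + 1)) fun h =>
          (F (net.stateOf h) : ℝ≥0∞)) + net.meanMaxWeight A (p.adaptive g).toPolicy t ≤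
        (expect (net.historyLaw A (p.adaptive g).toPolicy t) fun h =>
          (F (net.stateOf h) : ℝ≥0∞)) + C := by
  obtain ⟨r, hr1, hr⟩ := Network.exists_sum_mul_rate_le hload
  obtain ⟨m, hm⟩ := id hA
  obtain ⟨δ, hδ, hrδ⟩ : ∃ δ : ℝ≥0, 0 < δ ∧ r + δ = 1 :=
    ⟨1 - r, tsub_pos_of_lt hr1, add_tsub_cancel_of_le hr1.le⟩
  set D := ⌊net.delay⌋₊
  -- `M` controls the threshold and the reconfigurations at age `M` or more, and `K` controls
  -- those from poor schedules.
  obtain ⟨M, hM⟩ : ∃ M : ℕ, 2 * (D + 2 : ℝ≥0) + 1 ≤ M * δ := by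
    obtain ⟨M, hM⟩ := exists_nat_ge ((2 * (D + 2 : ℝ≥0) + 1) / δ)
    exact ⟨M, (div_le_iff₀ hδ).1 hM⟩
  obtain ⟨K, hK⟩ : ∃ K : ℕ, 2 * (D + 1 : ℝ≥0) * G + 1 ≤ K * δ := by
    obtain ⟨K, hK⟩ := exists_nat_ge ((2 * (D + 1 : ℝ≥0) * G + 1) / δ)
    exact ⟨K, (div_le_iff₀ hδ).1 hK⟩
  obtain ⟨C, hC⟩ := hg.exists_mul_le M
  obtain ⟨X, hX⟩ := hg.exists_forall_le ((K + 2 * slotChange N m * M : ℕ) : ℝ)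
  obtain ⟨B, hB⟩ : ∃ B : ℕ, ∀ (x : net.State) (T : net.Sched) (a : Packets N),
      (∀ i j, a i j ≤ m) →
      (x.next (net.hysteresis g x.queue x.sched T) a).lyapunov M K (slotChange N m) +
        2 * M * K * net.maxWeight x.queue ≤
      x.lyapunov M K (slotChange N m) + 2 * M * K * dot x.queue a +
        2 * (D + 2) * K * net.maxWeight x.queue +
        2 * (D + 1) * M *
          (net.maxWeight x.queue * (net.maxWeight x.queue - weight x.queue T.1)) +
        2 * (D + 2) * M * K * (net.maxWeight x.queue - weight x.queue T.1) + B :=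
    ⟨_, fun x T a ha => x.lyapunov_drift T hg.nonneg hC hX ha⟩
  refine ⟨Network.State.lyapunov M K (slotChange N m), 2 * (D + 2) * M * K * G + B, fun t => ?_⟩
  set P := (p.adaptive g).toPolicy
  set q := net.historyLaw A P t
  set w := net.meanMaxWeight A P t with hw
  have hwf : w ≠ ∞ := Network.meanMaxWeight_ne_top hA P t
  -- The mean drift given the history.
  have hstate : ∀ x : net.State,
      (expect A.slotLaw fun a => expect (p x.sched x.queue) fun T =>
        ((x.next (net.hysteresis g x.queue x.sched T) a).lyapunov M K (slotChange N m) : ℝ≥0∞)) +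
        2 * M * K * (net.maxWeight x.queue : ℝ≥0∞) ≤
      (x.lyapunov M K (slotChange N m) : ℝ≥0∞) +
        2 * M * K * (r * (net.maxWeight x.queue : ℝ≥0∞)) +
        2 * (D + 2) * K * (net.maxWeight x.queue : ℝ≥0∞) +
        2 * (D + 1) * M * ((net.maxWeight x.queue : ℝ≥0∞) * p.meanDeficit x.sched x.queue) +
        2 * (D + 2) * M * K * p.meanDeficit x.sched x.queue + B := by
    intro x
    have hdot : (expect A.slotLaw fun a => (dot x.queue a : ℝ≥0∞)) ≤
        r * (net.maxWeight x.queue : ℝ≥0∞) := by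
      rw [A.expect_slotLaw_dot]
      simp only [← hA.coe_rate]
      exact_mod_cast hr x.queue
    refine le_trans (b := expect A.slotLaw fun a => expect (p x.sched x.queue) fun T =>
      ((x.lyapunov M K (slotChange N m) : ℝ≥0∞) + 2 * M * K * (dot x.queue a : ℝ≥0∞) +
        2 * (D + 2) * K * (net.maxWeight x.queue : ℝ≥0∞) +
        2 * (D + 1) * M * ((net.maxWeight x.queue : ℝ≥0∞) *
          ((net.maxWeight x.queue - weight x.queue T.1 : ℕ) : ℝ≥0∞)) +
        2 * (D + 2) * M * K * ((net.maxWeight x.queue - weight x.queue T.1 : ℕ) : ℝ≥0∞) + B)) ?_ ?_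
    · rw [← expect_const A.slotLaw (2 * M * K * (net.maxWeight x.queue : ℝ≥0∞)), ← expect_add]
      refine expect_mono_support fun a ha => ?_
      rw [← expect_const (p x.sched x.queue) (2 * M * K * (net.maxWeight x.queue : ℝ≥0∞)),
        ← expect_add]
      refine expect_mono fun T => ?_
      exact_mod_cast hB x T a (Traffic.le_of_slotLaw_ne_zero hm ha)
    · simp only [expect_add, expect_const_mul, expect_const]
      unfold Network.MarkovPolicy.meanDeficit
      gcongr
  -- The mean drift.
  have hmean : (expect (net.historyLaw A P (t + 1)) fun h =>
        ((net.stateOf h).lyapunov M K (slotChange N m) : ℝ≥0∞)) + 2 * M * K * w ≤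
      (expect q fun h => ((net.stateOf h).lyapunov M K (slotChange N m) : ℝ≥0∞)) +
        2 * M * K * (r * w) + 2 * (D + 2) * K * w + 2 * (D + 1) * M * (G * w) +
        2 * (D + 2) * M * K * G + B := by
    rw [Network.expect_historyLaw_adaptive_succ p g t
        fun x => (x.lyapunov M K (slotChange N m) : ℝ≥0∞), hw, Network.meanMaxWeight,
      ← expect_const_mul, ← expect_add]
    refine (expect_mono fun h => hstate (net.stateOf h)).trans ?_
    simp only [expect_add, expect_const_mul, expect_const]
    have h1 := hG.expect_mul_meanDeficit_le t fun L => (net.maxWeight L : ℝ≥0∞)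
    have h2 := hG.expect_mul_meanDeficit_le t fun _ => 1
    simp only [one_mul, expect_const, mul_one] at h2
    gcongr
  -- The slack `δ` absorbs all terms that are proportional to `w`.
  have hcoef : (2 * M * K * r + 2 * (D + 2) * K + 2 * (D + 1) * M * G) + 1 ≤
      2 * (M : ℝ≥0) * K := by
    have hM' := mul_le_mul_right hM (K : ℝ≥0)
    have hK' := mul_le_mul_right hK (M : ℝ≥0)
    have hM1 : (1 : ℝ≥0) ≤ M := by
      have : M ≠ 0 := by
        rintro rfl
        simp at hM
      exact_mod_cast Nat.one_le_iff_ne_zero.2 this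
    have e : 2 * (M : ℝ≥0) * K = 2 * M * K * r + K * (M * δ) + M * (K * δ) := by
      calc 2 * (M : ℝ≥0) * K = 2 * M * K * (r + δ) := by rw [hrδ, mul_one]
        _ = _ := by ring
    rw [e]
    rw [← NNReal.coe_le_coe] at *
    push_cast at *
    nlinarith
  set c : ℝ≥0 := 2 * M * K * r + 2 * (D + 2) * K + 2 * (D + 1) * M * G with hc
  have hcw : (c : ℝ≥0∞) * w ≠ ∞ := ENNReal.mul_ne_top ENNReal.coe_ne_top hwf
  have hcoef' : (c : ℝ≥0∞) + 1 ≤ 2 * M * K := by exact_mod_cast hcoef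
  rw [← ENNReal.add_le_add_iff_right hcw]
  calc _ = (expect (net.historyLaw A P (t + 1)) fun h =>
        ((net.stateOf h).lyapunov M K (slotChange N m) : ℝ≥0∞)) + ((c : ℝ≥0∞) + 1) * w := by ring
    _ ≤ _ := add_le_add_right (mul_le_mul_left hcoef' w) _
    _ ≤ _ := hmean
    _ = _ := by
      rw [hc]
      push_cast
      ring

end MeanDrift

/-! ### From the maximum weight to the total queue length -/

section Total

variable {net : Network N} {A : Traffic N}

/-- A queue that no feasible schedule serves has no arrivals, if the load is less than one; its mean
length does not increase. Every other queue is bounded by the maximum weight. -/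
lemma Network.expect_queue_le (hA : A.Bounded) (hload : net.load A < 1) (P : net.Policy)
    (i j : Fin N) (t : ℕ) :
    (expect (net.historyLaw A P t) fun h => ((net.stateOf h).queue i j : ℝ≥0∞)) ≤
      net.meanMaxWeight A P t + net.initQueue i j := by
  by_cases hS : ∃ S : net.Sched, S.1 i j = true
  · obtain ⟨S, hS⟩ := hS
    refine le_add_right (expect_mono fun h => ?_)
    have h1 : (net.stateOf h).queue i j ≤ weight (net.stateOf h).queue S.1 := by
      calc (net.stateOf h).queue i j = (net.stateOf h).queue i j * (S.1 i j).toNat := by simp [hS]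
        _ ≤ ∑ j, (net.stateOf h).queue i j * (S.1 i j).toNat :=
          Finset.single_le_sum (f := fun j => (net.stateOf h).queue i j * (S.1 i j).toNat)
            (fun _ _ => Nat.zero_le _) (Finset.mem_univ j)
        _ ≤ _ := Finset.single_le_sum
            (f := fun i => ∑ j, (net.stateOf h).queue i j * (S.1 i j).toNat)
            (fun _ _ => Nat.zero_le _) (Finset.mem_univ i)
    exact_mod_cast h1.trans (net.weight_le_maxWeight _ S)
  · push Not at hS
    have hmean : A.mean i j = 0 := by
      obtain ⟨r, -, hr⟩ := Network.exists_sum_mul_rate_le hload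
      have h1 := hr fun k l => if k = i ∧ l = j then 1 else 0
      have h2 : net.maxWeight (fun k l => if k = i ∧ l = j then 1 else 0) = 0 := by
        refine Nat.le_zero.1 (Finset.sup_le fun S _ => ?_)
        refine (Finset.sum_eq_zero fun k _ => Finset.sum_eq_zero fun l _ => ?_).le
        by_cases hkl : k = i ∧ l = j
        · simp [hkl.1, hkl.2, hS S]
        · simp [hkl]
      rw [h2, Nat.cast_zero, mul_zero] at h1
      have h3 := Finset.sum_eq_zero_iff.1 (le_antisymm h1 zero_le) i (Finset.mem_univ i)
      have h4 := Finset.sum_eq_zero_iff.1 h3 j (Finset.mem_univ j)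
      have h5 : A.rate i j = 0 := by simpa using h4
      rw [← hA.coe_rate, h5, ENNReal.coe_zero]
    refine le_add_left ?_
    induction t with
    | zero => simp [Network.historyLaw, expect_pure, Network.stateOf, Network.init]
    | succ t ih =>
      refine le_trans ?_ ih
      rw [net.expect_historyLaw_succ]
      refine expect_mono fun h => ?_
      rw [← add_zero ((net.stateOf h).queue i j : ℝ≥0∞), ← hmean, ← A.expect_slotLaw_apply,
        ← expect_const A.slotLaw ((net.stateOf h).queue i j : ℝ≥0∞), ← expect_add]
      refine expect_mono fun a => ?_
      rw [← expect_const (P h a) (((net.stateOf h).queue i j : ℝ≥0∞) + a i j)]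
      refine expect_mono fun S => ?_
      simp only [Network.stateOf, Network.State.next]
      exact_mod_cast Nat.add_le_add_right (Nat.sub_le _ _) _

lemma Network.meanTotal_le (hA : A.Bounded) (hload : net.load A < 1) (P : net.Policy) (t : ℕ) :
    net.meanTotal A P t ≤ (N * N : ℕ) * net.meanMaxWeight A P t + total net.initQueue := by
  change (expect _ fun h => (total (net.stateOf h).queue : ℝ≥0∞)) ≤ _
  simp only [total, Nat.cast_sum, expect_sum]
  refine (Finset.sum_le_sum fun i _ => Finset.sum_le_sum fun j _ =>
    Network.expect_queue_le hA hload P i j t).trans (le_of_eq ?_)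
  simp [Finset.sum_add_distrib, mul_assoc]

end Total

/-- A constant bound on the time averages of the mean maximum weight gives strong stability. -/
lemma Network.stronglyStable_of_sum_meanMaxWeight_le {net : Network N} {A : Traffic N}
    (hA : A.Bounded) (hload : net.load A < 1) (P : net.Policy) {b C : ℝ≥0∞} (hb : b ≠ ∞)
    (hC : C ≠ ∞)
    (h : ∀ t : ℕ, ∑ τ ∈ Finset.range t, net.meanMaxWeight A P τ ≤ b + t * C) :
    net.StronglyStable A P := by
  have hlim : ∀ᶠ t : ℕ in Filter.atTop, (∑ τ ∈ Finset.range t, net.meanTotal A P τ) / (t : ℝ≥0∞) ≤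
      (N * N : ℕ) * (b + C) + total net.initQueue := by
    filter_upwards [Filter.eventually_ge_atTop 1] with t ht
    refine ENNReal.div_le_of_le_mul ?_
    have ht' : (1 : ℝ≥0∞) ≤ t := by exact_mod_cast ht
    calc ∑ τ ∈ Finset.range t, net.meanTotal A P τ
        ≤ ∑ τ ∈ Finset.range t, ((N * N : ℕ) * net.meanMaxWeight A P τ + total net.initQueue) :=
          Finset.sum_le_sum fun τ _ => Network.meanTotal_le hA hload P τ
      _ = (N * N : ℕ) * ∑ τ ∈ Finset.range t, net.meanMaxWeight A P τ +
            t * total net.initQueue := by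
          rw [Finset.sum_add_distrib, ← Finset.mul_sum, Finset.sum_const, Finset.card_range,
            nsmul_eq_mul]
      _ ≤ (N * N : ℕ) * (b * t + t * C) + t * total net.initQueue := by
          gcongr
          exact (h t).trans (add_le_add_left (le_mul_of_one_le_right zero_le ht') _)
      _ = _ := by ring
  refine (Filter.limsup_le_of_le (h := hlim)).trans_lt ?_
  finiteness

end OpticalSwitch

end

theorem theorem2 {N : ℕ} (net : OpticalSwitch.Network N) (hdelay : 0 < net.delay)
    (g : ℝ → ℝ) (hg : OpticalSwitch.IsHysteresis g) (p : net.MarkovPolicy)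
    (hp : ∀ A : OpticalSwitch.Traffic N, net.Supports A →
      ∃ G : NNReal, net.ExpectedWeightBound A (p.adaptive g).toPolicy p G) :
    net.ThroughputOptimal (p.adaptive g).toPolicy := by
  intro A hA
  obtain ⟨G, hG⟩ := hp A hA
  obtain ⟨F, C, hF⟩ :=
    OpticalSwitch.Network.exists_mean_drift hg hA.bounded hA.load_lt_one hG
  refine OpticalSwitch.Network.stronglyStable_of_sum_meanMaxWeight_le hA.bounded hA.load_lt_one
    _ (b := F net.init) (C := C) (ENNReal.natCast_ne_top _) ENNReal.coe_ne_top fun t => ?_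
  -- The drift bounds are added up over the slots before `t`.
  suffices h : OpticalSwitch.expect (net.historyLaw A (p.adaptive g).toPolicy t)
      (fun h => (F (net.stateOf h) : ENNReal)) +
        ∑ τ ∈ Finset.range t, net.meanMaxWeight A (p.adaptive g).toPolicy τ ≤
      F net.init + t * C from le_add_self.trans h
  induction t with
  | zero =>
    simp [OpticalSwitch.Network.historyLaw, OpticalSwitch.expect_pure,
      OpticalSwitch.Network.stateOf]
  | succ t ih =>
    rw [Finset.sum_range_succ, add_comm (∑ τ ∈ Finset.range t, _), ← add_assoc]
    refine (add_le_add_left (hF t) _).trans ?_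
    rw [add_right_comm]
    refine (add_le_add_left ih _).trans (le_of_eq ?_)
    push_cast
    ring
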